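/- For integers $1 \le \alpha \le n-1$, the Turán-connected graph $\mathsf{TC}(n,\alpha)$ is obtained from the disjoint union of $\alpha$ cliques with $n$ vertices in total, whose orders differ pairwise by at most one, by choosing a vertex $v$ of one clique of order $\lceil n/\alpha\rceil$ and adding $\alpha-1$ edges, which link $v$ to one vertex of each of the other cliques. (This determines the graph up to isomorphism.) Let $f_{\mathsf{TC}}(n,\alpha)$ be the Fibonacci index of $\mathsf{TC}(n,\alpha)$, that is, the number of its stable (independent) sets of vertices, including the empty set. Then $f_{\mathsf{TC}}$ is strictly increasing in $n$ and in $\alpha$: 1. for every fixed $\alpha \ge 1$, if $\alpha+1 \le n < m$, then $f_{\mathsf{TC}}(n,\alpha) < f_{\mathsf{TC}}(m,\alpha)$; 2. for every fixed $n$, if $1 \le \alpha < \beta \le n-1$, then $f_{\mathsf{TC}}(n,\alpha) < f_{\mathsf{TC}}(n,\beta)$. -/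

import Mathlib

/-- The Fibonacci index of a finite graph: the number of its stable (independent) sets,
including the empty set. -/
noncomputable def fibonacciIndex {V : Type*} [Fintype V] (G : SimpleGraph V) : ℕ :=
  {s : Finset V | G.IsIndepSet (s : Set V)}.ncard

/-- The Turán graph of order `n` with stability number `α` (`1 ≤ α ≤ n`), in the convention
where a Turán graph is a disjoint union of `α` balanced cliques. Mathlib's
`SimpleGraph.turanGraph n α` is the complete balanced `α`-partite graph, so this is its
complement: the cliques are the residue classes modulo `α` in `{0, …, n - 1}`. -/
def turanUnionGraph (n α : ℕ) : SimpleGraph (Fin n) :=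
  (SimpleGraph.turanGraph n α)ᶜ

/-- The Turán-connected graph of order `n` with stability number `α` (`1 ≤ α ≤ n - 1`):
the disjoint union of `α` balanced cliques together with `α - 1` additional edges, which link
one vertex of a largest clique (the vertex `0`; its clique, the residue class of `0` modulo `α`,
has `⌈n / α⌉` vertices) to one vertex of each remaining clique (the vertices `1, …, α - 1`). -/
def turanConnectedGraph (n α : ℕ) : SimpleGraph (Fin n) :=
  turanUnionGraph n α ⊔ SimpleGraph.fromRel fun v w : Fin n =>
    (v : ℕ) = 0 ∧ 1 ≤ (w : ℕ) ∧ (w : ℕ) < α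

/-- `fTC n α` is the Fibonacci index of the Turán-connected graph of order `n` with stability
number `α`, for `1 ≤ α ≤ n - 1`. -/
noncomputable def fTC (n α : ℕ) : ℕ :=
  fibonacciIndex (turanConnectedGraph n α)

/-!
Classifying stable sets by whether they contain the vertex `0` gives
`fTC n α = k₀ ∏ (kᵢ + 1) + ∏ kᵢ`, where `k₀` is the order of the clique of `0` and the `kᵢ` are the
orders of the other cliques. Monotonicity in `n` holds because `TC(n, α)` is an induced subgraph of
`TC(n + 1, α)`. For monotonicity in `α`, put `t = ⌊n / (α + 1)⌋` and transfer `t` vertices of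
`TC(n, α)`, one at a time, to a new clique linked to `0`, each time taking the last vertex. The
cliques that remain form a Turán-connected graph, the first transfer strictly increases the number
of stable sets, no later one decreases it, and after `t` transfers the graph is `TC(n, α + 1)`.
-/

section

open Finset

variable {V W ι : Type*} {G : SimpleGraph V} {H : SimpleGraph W}

lemma fibonacciIndex_lt_of_embedding [Fintype V] [Fintype W] (f : G ↪g H) {w : W}
    (hw : w ∉ Set.range f) : fibonacciIndex G < fibonacciIndex H := by
  unfold fibonacciIndex
  rw [← Set.ncard_image_of_injective _ (map_injective f.toEmbedding)]
  refine Set.ncard_lt_ncard ⟨?_, fun hsub => ?_⟩ (Set.toFinite _)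
  · rintro _ ⟨s, hs, rfl⟩
    rintro _ hx _ hy hxy
    obtain ⟨a, ha, rfl⟩ := mem_map.1 (mem_coe.1 hx)
    obtain ⟨b, hb, rfl⟩ := mem_map.1 (mem_coe.1 hy)
    exact fun h => hs ha hb (ne_of_apply_ne _ hxy) (f.map_adj_iff.1 h)
  · obtain ⟨s, -, hs⟩ := @hsub {w} (by simp [SimpleGraph.isIndepSet_iff])
    obtain ⟨a, -, ha⟩ := mem_map.1 (hs ▸ mem_singleton_self w)
    exact hw ⟨a, ha⟩

open Classical in
/-- The stable sets of `G` contained in `T`, that is, the stable sets of the subgraph induced on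
`T`; vertex deletion stays within a single vertex type by shrinking `T`. -/
noncomputable def indepSubsets (G : SimpleGraph V) (T : Finset V) : Finset (Finset V) :=
  {s ∈ T.powerset | G.IsIndepSet s}

lemma mem_indepSubsets {T s : Finset V} : s ∈ indepSubsets G T ↔ s ⊆ T ∧ G.IsIndepSet s := by
  simp [indepSubsets]

lemma fibonacciIndex_eq_card_indepSubsets [Fintype V] :
    fibonacciIndex G = #(indepSubsets G univ) := by
  rw [fibonacciIndex, ← Set.ncard_coe_finset]
  congr 1
  ext s
  simp [mem_indepSubsets]

lemma card_indepSubsets_eq_add [DecidableEq V] [DecidableRel G.Adj] {T : Finset V} {v : V}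
    (hv : v ∈ T) :
    #(indepSubsets G T) =
      #(indepSubsets G (T.erase v)) + #(indepSubsets G {w ∈ T | w ≠ v ∧ ¬G.Adj v w}) := by
  rw [← card_filter_add_card_filter_not (s := indepSubsets G T) (v ∉ ·)]
  congr 1
  · congr 1
    ext s
    simp only [mem_filter, mem_indepSubsets, subset_erase]
    tauto
  · refine card_nbij' (erase · v) (insert v) ?_ ?_ ?_ ?_
    · intro s hs
      simp only [coe_filter, mem_indepSubsets, not_not, Set.mem_ofPred_eq] at hs
      obtain ⟨⟨hsT, hind⟩, hvs⟩ := hs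
      refine mem_coe.2 (mem_indepSubsets.2 ⟨fun w hw => ?_, hind.mono (by simp)⟩)
      obtain ⟨hwv, hws⟩ := mem_erase.1 hw
      exact mem_filter.2 ⟨hsT hws, hwv, hind hvs hws hwv.symm⟩
    · intro s hs
      obtain ⟨hsT, hind⟩ := mem_indepSubsets.1 (mem_coe.1 hs)
      simp only [subset_iff, mem_filter] at hsT
      simp only [coe_filter, mem_indepSubsets, not_not, Set.mem_ofPred_eq, mem_insert_self,
        and_true, insert_subset_iff, hv, true_and, coe_insert]
      refine ⟨fun w hw => (hsT hw).1, ?_⟩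
      exact hind.insert fun w hw _ => ⟨(hsT hw).2.2, fun h => (hsT hw).2.2 h.symm⟩
    · intro s hs
      exact insert_erase (by simpa using (mem_filter.1 (mem_coe.1 hs)).2)
    · intro s hs
      exact erase_insert fun h => by
        simpa using (mem_indepSubsets.1 (mem_coe.1 hs)).1 h

lemma prod_card_fiber_eq_add [DecidableEq V] [DecidableEq ι] {I : Finset ι} {col : V → ι}
    {T : Finset V} {v : V} (hv : v ∈ T) (hvI : col v ∈ I) :
    ∏ c ∈ I, (#{w ∈ T | col w = c} + 1) =
      ∏ c ∈ I, (#{w ∈ T.erase v | col w = c} + 1) +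
        ∏ c ∈ I, (#{w ∈ {w ∈ T | col w ≠ col v} | col w = c} + 1) := by
  have hclass : #{w ∈ T.erase v | col w = col v} + 1 = #{w ∈ T | col w = col v} := by
    have hmem : v ∈ {w ∈ T | col w = col v} := mem_filter.2 ⟨hv, rfl⟩
    rw [filter_erase, card_erase_add_one hmem]
  have herase : ∏ c ∈ I.erase (col v), (#{w ∈ T.erase v | col w = c} + 1) =
      ∏ c ∈ I.erase (col v), (#{w ∈ T | col w = c} + 1) := by
    refine prod_congr rfl fun c hc => ?_
    congr 2
    grind
  have hfilter : ∏ c ∈ I, (#{w ∈ {w ∈ T | col w ≠ col v} | col w = c} + 1) =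
      ∏ c ∈ I.erase (col v), (#{w ∈ T | col w = c} + 1) := by
    rw [← mul_prod_erase I _ hvI, filter_filter, filter_false_of_mem (by tauto), card_empty,
      zero_add, one_mul]
    refine prod_congr rfl fun c hc => ?_
    congr 2
    grind
  rw [hfilter, ← mul_prod_erase I _ hvI, ← mul_prod_erase I _ hvI, herase, hclass]
  ring

lemma card_indepSubsets_eq_prod [DecidableEq ι] {I : Finset ι} {col : V → ι} {T : Finset V}
    (hcol : ∀ v ∈ T, col v ∈ I)
    (hadj : ∀ v ∈ T, ∀ w ∈ T, G.Adj v w ↔ v ≠ w ∧ col v = col w) :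
    #(indepSubsets G T) = ∏ c ∈ I, (#{v ∈ T | col v = c} + 1) := by
  classical
  induction T using Finset.strongInduction with
  | H T ih =>
    obtain rfl | ⟨v, hv⟩ := T.eq_empty_or_nonempty
    · simp [indepSubsets, filter_singleton]
    have restrict {S : Finset V} (hS : S ⊂ T) := ih S hS (fun w hw => hcol w (hS.1 hw))
      fun u hu w hw => hadj u (hS.1 hu) w (hS.1 hw)
    have hnbr : {w ∈ T | w ≠ v ∧ ¬G.Adj v w} = {w ∈ T | col w ≠ col v} := by
      refine filter_congr fun w hw => ?_
      rw [hadj v hv w hw]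
      grind
    rw [card_indepSubsets_eq_add hv, hnbr, restrict (erase_ssubset hv),
      restrict (filter_ssubset.2 ⟨v, hv, by simp⟩), ← prod_card_fiber_eq_add hv (hcol v hv)]

lemma turanConnectedGraph_adj {n α : ℕ} {v w : Fin n} :
    (turanConnectedGraph n α).Adj v w ↔ v ≠ w ∧ ((v : ℕ) % α = w % α ∨
      ((v : ℕ) = 0 ∧ 1 ≤ (w : ℕ) ∧ (w : ℕ) < α) ∨ ((w : ℕ) = 0 ∧ 1 ≤ (v : ℕ) ∧ (v : ℕ) < α)) := by
  simp only [turanConnectedGraph, turanUnionGraph, SimpleGraph.sup_adj, SimpleGraph.compl_adj,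
    SimpleGraph.turanGraph, SimpleGraph.fromRel_adj]
  tauto

lemma fTC_strictMono_left (α : ℕ) : StrictMono fun n => fTC n α := by
  intro n m hnm
  let f : turanConnectedGraph n α ↪g turanConnectedGraph m α :=
    ⟨Fin.castLEEmb hnm.le, by simp [turanConnectedGraph_adj]⟩
  refine fibonacciIndex_lt_of_embedding f (w := ⟨n, hnm⟩) ?_
  rintro ⟨v, hv⟩
  exact v.isLt.ne (congrArg Fin.val hv)

/-- The order of the clique of `turanConnectedGraph n α` formed by the residue class of `c`
modulo `α`, where `c < α`. -/
def turanCliqueOrder (n α c : ℕ) : ℕ :=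
  n.count (· % α = c)

lemma turanCliqueOrder_eq {n α c : ℕ} (hc : c < α) :
    turanCliqueOrder n α c = n / α + if c < n % α then 1 else 0 := by
  simpa only [turanCliqueOrder, Nat.ModEq, Nat.mod_eq_of_lt hc] using
    Nat.count_modEq_card n (pos_of_gt hc) c

lemma turanCliqueOrder_succ (n α c : ℕ) :
    turanCliqueOrder (n + 1) α c = turanCliqueOrder n α c + if n % α = c then 1 else 0 :=
  Nat.count_succ _ _

lemma card_filter_mod_eq (n α c : ℕ) :
    #{v : Fin n | (v : ℕ) % α = c} = turanCliqueOrder n α c := by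
  rw [turanCliqueOrder, Nat.count_eq_card_filter_range, ← Nat.Iio_eq_range,
    ← Fin.map_valEmbedding_univ, filter_map, card_map]
  rfl

/-- The number of stable sets of `turanConnectedGraph n α` that avoid the vertex `0`, where
`1 ≤ α ≤ n`; see `card_indepSubsets_avoiding`. -/
def stableAvoiding (n α : ℕ) : ℕ :=
  turanCliqueOrder n α 0 * ∏ c ∈ Ico 1 α, (turanCliqueOrder n α c + 1)

/-- The number of stable sets of `turanConnectedGraph n α` that contain the vertex `0`, where
`1 ≤ α ≤ n`; see `card_indepSubsets_containing`. -/
def stableContaining (n α : ℕ) : ℕ :=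
  ∏ c ∈ Ico 1 α, turanCliqueOrder n α c

lemma card_indepSubsets_avoiding {n α : ℕ} (hn : 0 < n) (hα : 0 < α) :
    #(indepSubsets (turanConnectedGraph n α) (univ.erase ⟨0, hn⟩)) = stableAvoiding n α := by
  have hcol : ∀ v ∈ univ.erase (⟨0, hn⟩ : Fin n), (v : ℕ) % α ∈ range α :=
    fun v _ => mem_range.2 (Nat.mod_lt _ hα)
  rw [card_indepSubsets_eq_prod hcol, prod_range_eq_mul_Ico _ hα, stableAvoiding]
  · congr 1
    · rw [filter_erase, card_erase_add_one (by simp), card_filter_mod_eq]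
    · refine prod_congr rfl fun c hc => ?_
      rw [filter_erase, erase_eq_of_notMem, card_filter_mod_eq]
      simpa using (Nat.one_le_iff_ne_zero.1 (mem_Ico.1 hc).1).symm
  · intro v hv w hw
    have hv0 : (v : ℕ) ≠ 0 := by simpa [Fin.ext_iff] using hv
    have hw0 : (w : ℕ) ≠ 0 := by simpa [Fin.ext_iff] using hw
    simp [turanConnectedGraph_adj, hv0, hw0]

lemma ne_zero_and_not_adj_zero_iff {n α : ℕ} (hn : 0 < n) {w : Fin n} :
    w ≠ ⟨0, hn⟩ ∧ ¬(turanConnectedGraph n α).Adj ⟨0, hn⟩ w ↔ (w : ℕ) % α ≠ 0 ∧ α ≤ w := by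
  simp only [turanConnectedGraph_adj, ne_eq, Fin.ext_iff, Nat.zero_mod]
  rcases lt_or_ge (w : ℕ) α with hw | hw
  · grind [Nat.mod_eq_of_lt hw]
  · grind

lemma card_filter_le_and_mod_eq {n α c : ℕ} (hc : c < α) (h : α ≤ n) :
    #{w : Fin n | α ≤ w ∧ (w : ℕ) % α = c} + 1 = turanCliqueOrder n α c := by
  have herase : ({w | α ≤ w ∧ (w : ℕ) % α = c} : Finset (Fin n)) =
      ({w | (w : ℕ) % α = c} : Finset (Fin n)).erase ⟨c, hc.trans_le h⟩ := by
    ext w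
    simp only [mem_filter, mem_univ, true_and, mem_erase, ne_eq, Fin.ext_iff]
    rcases lt_or_ge (w : ℕ) α with hw | hw
    · rw [Nat.mod_eq_of_lt hw]
      omega
    · grind
  rw [herase, card_erase_add_one (by simp [Nat.mod_eq_of_lt hc]), card_filter_mod_eq]

lemma card_indepSubsets_containing {n α : ℕ} (hα : 0 < α) (h : α ≤ n) :
    #(indepSubsets (turanConnectedGraph n α) {w | (w : ℕ) % α ≠ 0 ∧ α ≤ w}) =
      stableContaining n α := by
  have hcol : ∀ w ∈ ({w | (w : ℕ) % α ≠ 0 ∧ α ≤ w} : Finset (Fin n)), (w : ℕ) % α ∈ Ico 1 α :=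
    fun w hw => mem_Ico.2 ⟨Nat.one_le_iff_ne_zero.2 (mem_filter.1 hw).2.1, Nat.mod_lt _ hα⟩
  rw [card_indepSubsets_eq_prod hcol, stableContaining]
  · refine prod_congr rfl fun c hc => ?_
    rw [← card_filter_le_and_mod_eq (mem_Ico.1 hc).2 h, filter_filter]
    congr 2
    grind
  · intro v hv w hw
    have hvα : α ≤ v := (mem_filter.1 hv).2.2
    have hwα : α ≤ w := (mem_filter.1 hw).2.2
    simp [turanConnectedGraph_adj, hvα.not_gt, hwα.not_gt]

lemma fTC_eq_add {n α : ℕ} (hα : 0 < α) (h : α ≤ n) :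
    fTC n α = stableAvoiding n α + stableContaining n α := by
  classical
  have hn : 0 < n := hα.trans_le h
  rw [fTC, fibonacciIndex_eq_card_indepSubsets, card_indepSubsets_eq_add (mem_univ ⟨0, hn⟩),
    card_indepSubsets_avoiding hn hα]
  simp only [ne_zero_and_not_adj_zero_iff, card_indepSubsets_containing hα h]

lemma prod_turanCliqueOrder_succ_of_notMem {n α : ℕ} {J : Finset ℕ} (h : n % α ∉ J) (f : ℕ → ℕ) :
    ∏ c ∈ J, f (turanCliqueOrder (n + 1) α c) = ∏ c ∈ J, f (turanCliqueOrder n α c) := by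
  refine prod_congr rfl fun c hc => ?_
  rw [turanCliqueOrder_succ, if_neg (ne_of_mem_of_not_mem hc h).symm, add_zero]

lemma turanCliqueOrder_mod (n : ℕ) {α : ℕ} (hα : 0 < α) :
    turanCliqueOrder n α (n % α) = n / α := by
  simp [turanCliqueOrder_eq (Nat.mod_lt n hα)]

lemma exists_stable_succ_of_mod_eq_zero {n α : ℕ} (hα : 0 < α) (h : n % α = 0) :
    ∃ P, 0 < P ∧ stableAvoiding n α = n / α * P ∧ stableAvoiding (n + 1) α = (n / α + 1) * P ∧
      stableContaining (n + 1) α = stableContaining n α := by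
  have hnot : n % α ∉ Ico 1 α := by simp [h]
  have hzero : turanCliqueOrder n α 0 = n / α := by simpa only [h] using turanCliqueOrder_mod n hα
  refine ⟨∏ c ∈ Ico 1 α, (turanCliqueOrder n α c + 1), prod_pos fun c _ => Nat.succ_pos _, ?_, ?_,
    prod_turanCliqueOrder_succ_of_notMem hnot id⟩
  · rw [stableAvoiding, hzero]
  · rw [stableAvoiding, prod_turanCliqueOrder_succ_of_notMem hnot (· + 1), turanCliqueOrder_succ,
      hzero, if_pos h]

-- The new vertex `n` enlarges the clique of `n % α`; `P` and `Q` are the products of `k + 1` and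
-- `k` over the orders `k` of the cliques other than that one and the clique of `0`.
lemma exists_stable_succ_of_mod_ne_zero {n α : ℕ} (hα : 0 < α) (h : n % α ≠ 0) :
    ∃ P Q, 0 < P ∧ Q ≤ P ∧
      stableAvoiding n α = (n / α + 1) * ((n / α + 1) * P) ∧
      stableAvoiding (n + 1) α = (n / α + 1) * ((n / α + 2) * P) ∧
      stableContaining n α = n / α * Q ∧
      stableContaining (n + 1) α = (n / α + 1) * Q := by
  have hmem : n % α ∈ Ico 1 α := mem_Ico.2 ⟨Nat.one_le_iff_ne_zero.2 h, Nat.mod_lt n hα⟩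
  have hzero : turanCliqueOrder n α 0 = n / α + 1 := by
    rw [turanCliqueOrder_eq hα, if_pos (Nat.pos_of_ne_zero h)]
  have hzero' : turanCliqueOrder (n + 1) α 0 = n / α + 1 := by
    rw [turanCliqueOrder_succ, if_neg h, hzero]
  have hprod (f : ℕ → ℕ) : ∏ c ∈ Ico 1 α, f (turanCliqueOrder n α c) =
      f (n / α) * ∏ c ∈ (Ico 1 α).erase (n % α), f (turanCliqueOrder n α c) := by
    rw [← mul_prod_erase _ _ hmem, turanCliqueOrder_mod n hα]
  have hprod' (f : ℕ → ℕ) : ∏ c ∈ Ico 1 α, f (turanCliqueOrder (n + 1) α c) =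
      f (n / α + 1) * ∏ c ∈ (Ico 1 α).erase (n % α), f (turanCliqueOrder n α c) := by
    rw [← mul_prod_erase _ _ hmem, prod_turanCliqueOrder_succ_of_notMem (notMem_erase _ _) f,
      turanCliqueOrder_succ, if_pos rfl, turanCliqueOrder_mod n hα]
  refine ⟨∏ c ∈ (Ico 1 α).erase (n % α), (turanCliqueOrder n α c + 1),
    ∏ c ∈ (Ico 1 α).erase (n % α), turanCliqueOrder n α c, prod_pos fun c _ => Nat.succ_pos _,
    prod_le_prod' fun c _ => Nat.le_succ _, ?_, ?_, hprod id, hprod' id⟩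
  · rw [stableAvoiding, hzero, hprod (· + 1)]
  · rw [stableAvoiding, hzero', hprod' (· + 1)]

/-- The Fibonacci index of the graph obtained from `turanConnectedGraph n α` and a clique of order
`t ≥ 1` by linking the vertex `0` to one vertex of that clique: a stable set extends in `t + 1` ways
to the new clique if it avoids `0`, and in `t` ways if it contains `0`. -/
def linkedIndex (n α t : ℕ) : ℕ :=
  (t + 1) * stableAvoiding n α + t * stableContaining n α

lemma linkedIndex_succ_le {n α t : ℕ} (hα : 0 < α) (h : t * α < n) :
    linkedIndex (n + 1) α t ≤ linkedIndex n α (t + 1) := by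
  by_cases hmod : n % α = 0
  · obtain ⟨P, -, hA, hA', hC⟩ := exists_stable_succ_of_mod_eq_zero hα hmod
    have ht : t < n / α := (Nat.lt_div_iff_mul_lt' (Nat.dvd_of_mod_eq_zero hmod) t).2 (by linarith)
    obtain ⟨d, hd⟩ := Nat.exists_eq_add_of_lt ht
    have gain : linkedIndex n α (t + 1) =
        linkedIndex (n + 1) α t + (d * P + stableContaining n α) := by
      rw [linkedIndex, linkedIndex, hA, hA', hC, hd]
      ring
    exact gain ▸ Nat.le_add_right _ _
  · obtain ⟨P, Q, -, -, hA, hA', hC, hC'⟩ := exists_stable_succ_of_mod_ne_zero hα hmod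
    obtain ⟨d, hd⟩ := Nat.exists_eq_add_of_le ((Nat.le_div_iff_mul_le hα).2 h.le)
    have gain : linkedIndex n α (t + 1) =
        linkedIndex (n + 1) α t + d * ((n / α + 1) * P + Q) := by
      rw [linkedIndex, linkedIndex, hA, hA', hC, hC', hd]
      ring
    exact gain ▸ Nat.le_add_right _ _

lemma linkedIndex_add_le {n α t d : ℕ} (hα : 0 < α) (h : (t + d) * α < n + α) :
    linkedIndex (n + d) α t ≤ linkedIndex n α (t + d) := by
  induction d generalizing n with
  | zero => rfl
  | succ d ih =>
    calc linkedIndex (n + (d + 1)) α t = linkedIndex (n + 1 + d) α t := by ring_nf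
      _ ≤ linkedIndex (n + 1) α (t + d) := ih (by nlinarith)
      _ ≤ linkedIndex n α (t + d + 1) := linkedIndex_succ_le hα (by nlinarith)

lemma fTC_succ_lt_linkedIndex_one {n α : ℕ} (hα : 0 < α) (h : α < n) :
    fTC (n + 1) α < linkedIndex n α 1 := by
  by_cases hmod : n % α = 0
  · obtain ⟨P, hP, hA, hA', hC⟩ := exists_stable_succ_of_mod_eq_zero hα hmod
    have hs : 1 < n / α := (Nat.lt_div_iff_mul_lt' (Nat.dvd_of_mod_eq_zero hmod) 1).2 (by linarith)
    have gain : linkedIndex n α 1 + P = fTC (n + 1) α + n / α * P := by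
      rw [fTC_eq_add hα (by omega), linkedIndex, hA, hA', hC]
      ring
    have hlt : P < n / α * P := lt_mul_of_one_lt_left hP hs
    omega
  · obtain ⟨P, Q, hP, hQP, hA, hA', hC, hC'⟩ := exists_stable_succ_of_mod_ne_zero hα hmod
    have hs : 1 ≤ n / α := Nat.div_pos h.le hα
    have gain : linkedIndex n α 1 + Q = fTC (n + 1) α + n / α * (n / α + 1) * P := by
      rw [fTC_eq_add hα (by omega), linkedIndex, hA, hA', hC, hC']
      ring
    have hlt : Q < n / α * (n / α + 1) * P :=
      hQP.trans_lt (lt_mul_of_one_lt_left hP (by nlinarith))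
    omega

lemma turanCliqueOrder_sub_div {n α c : ℕ} (hc : c < α) :
    turanCliqueOrder (n - n / (α + 1)) α c = turanCliqueOrder n (α + 1) c := by
  have hα : 0 < α := pos_of_gt hc
  have hsub : n - n / (α + 1) = n % (α + 1) + α * (n / (α + 1)) := by
    have := Nat.mod_add_div n (α + 1)
    rw [add_one_mul] at this
    omega
  rw [turanCliqueOrder_eq hc, turanCliqueOrder_eq (hc.trans α.lt_succ_self), hsub,
    Nat.add_mul_div_left _ _ hα, Nat.add_mul_mod_self_left]
  rcases (Nat.le_of_lt_succ (Nat.mod_lt n α.succ_pos)).lt_or_eq with hr | hr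
  · rw [Nat.div_eq_of_lt hr, Nat.mod_eq_of_lt hr, zero_add]
  · rw [hr, Nat.div_self hα, Nat.mod_self, if_neg c.not_lt_zero, if_pos hc]
    ring

lemma linkedIndex_sub_div {n α : ℕ} (hα : 0 < α) (h : α < n) :
    linkedIndex (n - n / (α + 1)) α (n / (α + 1)) = fTC n (α + 1) := by
  have hlast : turanCliqueOrder n (α + 1) α = n / (α + 1) := by
    rw [turanCliqueOrder_eq α.lt_succ_self,
      if_neg (Nat.le_of_lt_succ (Nat.mod_lt n α.succ_pos)).not_gt, add_zero]
  have hprod (f : ℕ → ℕ) : ∏ c ∈ Ico 1 (α + 1), f (turanCliqueOrder n (α + 1) c) =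
      (∏ c ∈ Ico 1 α, f (turanCliqueOrder (n - n / (α + 1)) α c)) * f (n / (α + 1)) := by
    rw [prod_Ico_succ_top hα, hlast]
    congr 1
    exact prod_congr rfl fun c hc => by rw [turanCliqueOrder_sub_div (mem_Ico.1 hc).2]
  rw [fTC_eq_add α.succ_pos h, linkedIndex, stableAvoiding, stableAvoiding, stableContaining,
    stableContaining, hprod (· + 1), hprod (fun k => k), turanCliqueOrder_sub_div hα]
  ring

lemma fTC_lt_fTC_succ_right {n α : ℕ} (hα : 0 < α) (h : α + 1 < n) :
    fTC n α < fTC n (α + 1) := by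
  have ht : 1 ≤ n / (α + 1) := Nat.div_pos h.le α.succ_pos
  have htn : n / (α + 1) * α + n / (α + 1) ≤ n := Nat.div_mul_le_self n (α + 1)
  set t := n / (α + 1)
  calc fTC n α = fTC (n - 1 + 1) α := by rw [Nat.sub_add_cancel (by omega)]
    _ < linkedIndex (n - 1) α 1 := fTC_succ_lt_linkedIndex_one hα (by omega)
    _ = linkedIndex (n - t + (t - 1)) α 1 := by
      congr 1
      omega
    _ ≤ linkedIndex (n - t) α (1 + (t - 1)) :=
      linkedIndex_add_le hα (by rw [Nat.add_sub_cancel' ht]; omega)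
    _ = linkedIndex (n - t) α t := by rw [Nat.add_sub_cancel' ht]
    _ = fTC n (α + 1) := linkedIndex_sub_div hα (by omega)

end

/-- The function `fTC` is defined for `1 ≤ α ≤ n - 1`. It is strictly increasing in `n` for fixed
`α` (where `n` ranges over `n ≥ α + 1`), and strictly increasing in `α` for fixed `n`
(where `α` ranges over `1 ≤ α ≤ n - 1`). -/
theorem proposition4p5 :
    (∀ α : ℕ, 1 ≤ α → StrictMonoOn (fun n : ℕ => fTC n α) (Set.Ici (α + 1))) ∧
      (∀ n : ℕ, StrictMonoOn (fun α : ℕ => fTC n α) (Set.Ico 1 n)) := by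
  refine ⟨fun α _ => (fTC_strictMono_left α).strictMonoOn _, fun n => ?_⟩
  refine strictMonoOn_of_lt_add_one Set.ordConnected_Ico fun α _ hα hα' => ?_
  exact fTC_lt_fTC_succ_right hα.1 hα'.2
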